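/- Let $p\ge 1$ and let $\mathcal A$ be a Borel set of real $p\times p$ matrices, each of which is entrywise non-negative, column-stochastic (every column sums to $1$) and allowable (every row and every column contains a strictly positive entry). Assume that $\mathcal A$ is primitive, i.e. some finite non-empty product of elements of $\mathcal A$, repetitions allowed, has only strictly positive entries. Let $(A_n)_{n\ge1}$ be an i.i.d. sequence of random matrices on a probability space with values (almost surely) in $\mathcal A$, whose common distribution is fully supported on $\mathcal A$, i.e. every neighbourhood of every element of $\mathcal A$ has positive probability under the law of $A_1$. Put $\alpha_1=\min\{A_1^{ij} : A_1^{ij}\ne 0\}$ and assume $\mathbb E\,\min(\log\alpha_1,0)>-\infty$. For $n\ge0$ let $w_n=A_nA_{n-1}\cdots A_1\mathbf 1\in\mathbb R^p$, where $\mathbf 1$ is the all-ones vector (so $w_0=\mathbf 1$). Then almost surely $\min_i w_n^i>0$ for all $n$ and $$\limsup_{n\to\infty}\frac1n\log\frac1{\min_i w_n^i}\le 0 .$$ -/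

import Mathlib

open MeasureTheory ProbabilityTheory Filter
open scoped Matrix

namespace RatioConsensus

/-- Entrywise (product) sigma-algebra on real `p × p` matrices; it is the Borel one, see below. -/
instance matrixMeasurableSpace (p : ℕ) : MeasurableSpace (Matrix (Fin p) (Fin p) ℝ) :=
  inferInstanceAs (MeasurableSpace (Fin p → Fin p → ℝ))

instance matrixBorelSpace (p : ℕ) : BorelSpace (Matrix (Fin p) (Fin p) ℝ) :=
  inferInstanceAs (BorelSpace (Fin p → Fin p → ℝ))

/-- Every row and every column contains a strictly positive element. -/
def Allowable {p : ℕ} (B : Matrix (Fin p) (Fin p) ℝ) : Prop :=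
  (∀ i, ∃ j, 0 < B i j) ∧ (∀ j, ∃ i, 0 < B i j)

/-- A set of matrices is primitive if some nonempty product of its elements (repetitions allowed)
is entrywise strictly positive. -/
def Primitive {p : ℕ} (𝒜 : Set (Matrix (Fin p) (Fin p) ℝ)) : Prop :=
  ∃ l : List (Matrix (Fin p) (Fin p) ℝ),
    l ≠ [] ∧ (∀ B ∈ l, B ∈ 𝒜) ∧ ∀ i j, 0 < l.prod i j

/-- The smallest nonzero entry of a matrix. (For allowable matrices with `0 < p` the set is finite
and nonempty, so that the infimum is a minimum.) -/
noncomputable def minNonzeroEntry {p : ℕ} (B : Matrix (Fin p) (Fin p) ℝ) : ℝ :=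
  sInf {x : ℝ | x ≠ 0 ∧ ∃ i j, B i j = x}

/-- The standing assumptions on the set `𝒜` and the process `A 1, A 2, …`
(the value `A 0` plays no role). -/
structure StandingAssumption {p : ℕ} {Ω : Type*} [MeasurableSpace Ω] (μ : Measure Ω)
    (𝒜 : Set (Matrix (Fin p) (Fin p) ℝ)) (A : ℕ → Ω → Matrix (Fin p) (Fin p) ℝ) : Prop where
  measurableSet : MeasurableSet 𝒜
  /-- entrywise non-negative with all column sums equal to one -/
  colStochastic : ∀ B ∈ 𝒜, B ∈ Matrix.colStochastic ℝ (Fin p)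
  allowable : ∀ B ∈ 𝒜, Allowable B
  primitive : Primitive 𝒜
  measurable : ∀ n, 1 ≤ n → Measurable (A n)
  mem : ∀ n, 1 ≤ n → ∀ᵐ ω ∂μ, A n ω ∈ 𝒜
  indep : iIndepFun (fun n => A (n + 1)) μ
  identDistrib : ∀ n, 1 ≤ n → IdentDistrib (A n) (A 1) μ μ
  /-- every (relatively) open nonempty part of `𝒜` is charged by the distribution of `A 1` -/
  fullSupport : 𝒜 ⊆ (μ.map (A 1)).support
  /-- the expectation of the nonpositive variable `min (log α₁) 0` is not `-∞` -/
  logIntegrable : Integrable (fun ω => min (Real.log (minNonzeroEntry (A 1 ω))) 0) μ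

/-- The product `A n * A (n - 1) * ⋯ * A 1` (the identity for `n = 0`). -/
def prodM {p : ℕ} {Ω : Type*} (A : ℕ → Ω → Matrix (Fin p) (Fin p) ℝ) :
    ℕ → Ω → Matrix (Fin p) (Fin p) ℝ
  | 0, _ => 1
  | n + 1, ω => A (n + 1) ω * prodM A n ω

/-- The weight vector `w n = A n * ⋯ * A 1 * 𝟏`. -/
def weight {p : ℕ} {Ω : Type*} (A : ℕ → Ω → Matrix (Fin p) (Fin p) ℝ) (n : ℕ) (ω : Ω) :
    Fin p → ℝ :=
  prodM A n ω *ᵥ 1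

/-- The smallest weight at time `n`. -/
def minWeight {p : ℕ} [NeZero p] {Ω : Type*} (A : ℕ → Ω → Matrix (Fin p) (Fin p) ℝ)
    (n : ℕ) (ω : Ω) : ℝ :=
  Finset.univ.inf' Finset.univ_nonempty (weight A n ω)

end RatioConsensus

namespace RatioConsensus

/-! ### Deterministic estimates on real sequences -/

/-! Put `L n = -log (minWeight A n ω)`. Each row of an allowable matrix has a positive entry, so one
step raises `L` by at most `x n`, minus the logarithm of the smallest nonzero entry, cut off at `0`
(`neg_log_minWeight_succ_le`). These increments are i.i.d. and integrable, so their averages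
converge, but this alone gives only linear growth.

The growth is undone by resets. By full support and independence, a block of matrices close to the
factors of a positive product has positive probability. Column sums keep the total weight equal to
`p`, so such a block brings every weight above a fixed constant, whatever the past
(`le_minWeight_of_mem_aboveHalf`). By the strong law for disjoint blocks, resets have positive
frequency, so the last one before time `n` lies only `o(n)` back. Since the partial sums of `x` are
`a n + o(n)`, they grow by only `o(n)` from then on, and `L n ≤ o(n)`
(`eventually_div_le_of_reset`). -/

lemma exists_abs_sub_le_of_tendsto_div {S : ℕ → ℝ} {a : ℝ}
    (h : Tendsto (fun n : ℕ => S n / n) atTop (nhds a)) {ε : ℝ} (hε : 0 < ε) :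
    ∃ C : ℝ, ∀ n : ℕ, |S n - n * a| ≤ ε * n + C := by
  obtain ⟨N, hN⟩ := (Metric.tendsto_atTop.1 h) ε hε
  refine ⟨∑ n ∈ Finset.range (N + 1), |S n - n * a|, fun n => ?_⟩
  rcases le_or_gt n N with hn | hn
  · have h1 : |S n - n * a| ≤ ∑ n ∈ Finset.range (N + 1), |S n - n * a| :=
      Finset.single_le_sum (f := fun n : ℕ => |S n - n * a|) (fun _ _ => abs_nonneg _)
        (Finset.mem_range.2 (by omega))
    have : 0 ≤ ε * n := by positivity
    linarith
  · have h0 : (0 : ℝ) < n := by exact_mod_cast (by omega : 0 < n)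
    have h1 := hN n hn.le
    rw [Real.dist_eq] at h1
    have h2 : S n - n * a = (S n / n - a) * n := by field_simp
    rw [h2, abs_mul, abs_of_pos h0]
    have h3 : 0 ≤ ∑ n ∈ Finset.range (N + 1), |S n - n * a| :=
      Finset.sum_nonneg fun _ _ => abs_nonneg _
    nlinarith

lemma le_add_sum_sub_sum {L x : ℕ → ℝ} (hL : ∀ n, L (n + 1) ≤ L n + x n) {t n : ℕ}
    (htn : t ≤ n) :
    L n ≤ L t + (∑ i ∈ Finset.range n, x i - ∑ i ∈ Finset.range t, x i) := by
  induction n, htn using Nat.le_induction with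
  | base => simp
  | succ n _ ih => rw [Finset.sum_range_succ]; linarith [hL n]

/-- `J * m` is the time of the last reset among the first `k` blocks, or `0` if there is none;
equality of the sums records that no reset is counted afterwards. -/
lemma exists_reset_index {L y : ℕ → ℝ} {m : ℕ} {K : ℝ} (hL0 : L 0 ≤ K)
    (hy : ∀ j, y j = 0 ∨ L ((j + 1) * m) ≤ K) (k : ℕ) :
    ∃ J ≤ k, ∑ j ∈ Finset.range J, y j = ∑ j ∈ Finset.range k, y j ∧ L (J * m) ≤ K := by
  induction k with
  | zero => exact ⟨0, le_rfl, rfl, by simpa using hL0⟩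
  | succ k ih =>
    rcases hy k with h | h
    · obtain ⟨J, hJ, hs, hK⟩ := ih
      exact ⟨J, hJ.trans k.le_succ, by rw [Finset.sum_range_succ, h, hs, add_zero], hK⟩
    · exact ⟨k + 1, le_rfl, rfl, h⟩

/-- A sequence whose increments have converging averages, and which is reset below a fixed level
with positive frequency, grows at most sublinearly. -/
lemma eventually_div_le_of_reset {L x y : ℕ → ℝ} {m : ℕ} (hm : 0 < m) {K a q : ℝ} (hq : 0 < q)
    (hL0 : L 0 ≤ K) (hL : ∀ n, L (n + 1) ≤ L n + x n)
    (hy : ∀ j, y j = 0 ∨ L ((j + 1) * m) ≤ K)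
    (hx : Tendsto (fun n : ℕ => (∑ i ∈ Finset.range n, x i) / n) atTop (nhds a))
    (hyq : Tendsto (fun n : ℕ => (∑ i ∈ Finset.range n, y i) / n) atTop (nhds q))
    {ε : ℝ} (hε : 0 < ε) : ∀ᶠ n : ℕ in atTop, 1 / (n : ℝ) * L n ≤ ε := by
  -- `R` collects the coefficients of `δ * n` in the final estimate, so that they add up to `ε / 2`.
  set R : ℝ := |a| * (m * (2 / q)) + 2 with hR
  have hRpos : 0 < R := by positivity
  set δ : ℝ := ε / 2 / R with hδ
  have hδpos : 0 < δ := by positivity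
  obtain ⟨C₁, hC₁⟩ := exists_abs_sub_le_of_tendsto_div hyq hδpos
  obtain ⟨C₂, hC₂⟩ := exists_abs_sub_le_of_tendsto_div hx hδpos
  set D : ℝ := K + |a| * (m * (2 * C₁ / q) + m) + 2 * C₂ with hD
  have key : ∀ n : ℕ, L n ≤ D + ε / 2 * n := by
    intro n
    obtain ⟨J, hJ, hs, hK⟩ := exists_reset_index hL0 hy (n / m)
    have hkm : n / m * m ≤ n := Nat.div_mul_le_self n m
    have htn : J * m ≤ n := (Nat.mul_le_mul_right m hJ).trans hkm
    have hnk : n ≤ n / m * m + m := by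
      have := Nat.div_add_mod n m
      have := Nat.mod_lt n hm
      nlinarith
    have hkn : n / m ≤ n := Nat.div_le_self n m
    set k := n / m
    have e1 := abs_le.1 (hC₁ k)
    have e2 := abs_le.1 (hC₁ J)
    have e3 := abs_le.1 (hC₂ n)
    have e4 := abs_le.1 (hC₂ (J * m))
    rw [hs] at e2
    have h1 := le_add_sum_sub_sum hL htn
    have hJ' : (J : ℝ) ≤ k := by exact_mod_cast hJ
    have hkn' : (k : ℝ) ≤ n := by exact_mod_cast hkn
    have htn' : ((J * m : ℕ) : ℝ) ≤ n := by exact_mod_cast htn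
    have hnk' : (n : ℝ) ≤ k * m + m := by exact_mod_cast hnk
    -- The sums of `y` up to `J` and up to `k` agree, so `k * q` and `J * q` differ only by the two
    -- error terms.
    have hgap : ((k : ℝ) - J) ≤ (2 * δ * n + 2 * C₁) / q := by
      rw [le_div_iff₀ hq]
      have : δ * k ≤ δ * n := by gcongr
      have : δ * J ≤ δ * k := by gcongr
      linarith [e1.1, e2.2]
    have hgap2 : (n : ℝ) - (J * m : ℕ) ≤ m * ((2 * δ * n + 2 * C₁) / q) + m := by
      push_cast
      have : (m : ℝ) * (k - J) ≤ m * ((2 * δ * n + 2 * C₁) / q) := by gcongr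
      linarith
    have hgap3 : a * ((n : ℝ) - (J * m : ℕ))
        ≤ |a| * (m * ((2 * δ * n + 2 * C₁) / q) + m) :=
      (mul_le_mul_of_nonneg_right (le_abs_self a) (by linarith)).trans
        (mul_le_mul_of_nonneg_left hgap2 (abs_nonneg a))
    have h5 : δ * (J * m : ℕ) ≤ δ * n := by gcongr
    have h6 : δ * R = ε / 2 := by rw [hδ]; field_simp
    have h7 : D + ε / 2 * n
        = K + |a| * (m * ((2 * δ * n + 2 * C₁) / q) + m) + 2 * δ * n + 2 * C₂ := by
      rw [← h6, hD, hR]; ring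
    rw [h7]
    linarith [e3.2, e4.1]
  filter_upwards [(tendsto_natCast_atTop_atTop (R := ℝ)).eventually_ge_atTop (D / (ε / 2)),
    eventually_gt_atTop 0] with n hn hn0
  have hn0' : (0 : ℝ) < n := by exact_mod_cast hn0
  rw [div_le_iff₀ (by positivity)] at hn
  rw [one_div, inv_mul_le_iff₀ hn0']
  linarith [key n]

/-! ### The smallest nonzero entry -/

/-- The smallest among the nonzero entries and, if some entry vanishes, the number `1`.
Unlike `minNonzeroEntry` it is a finite minimum of measurable functions. -/
noncomputable def minEntryOrOne {p : ℕ} [NeZero p] (B : Matrix (Fin p) (Fin p) ℝ) : ℝ :=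
  Finset.univ.inf' Finset.univ_nonempty
    fun ij : Fin p × Fin p => if B ij.1 ij.2 = 0 then 1 else B ij.1 ij.2

lemma measurable_entry {p : ℕ} (i j : Fin p) :
    Measurable fun B : Matrix (Fin p) (Fin p) ℝ => B i j :=
  (measurable_pi_apply (X := fun _ : Fin p => ℝ) j).comp
    (measurable_pi_apply (X := fun _ : Fin p => Fin p → ℝ) i)

section Entry

variable {p : ℕ} [NeZero p] {B : Matrix (Fin p) (Fin p) ℝ}

lemma measurable_minEntryOrOne : Measurable (minEntryOrOne (p := p)) := by
  have h : Measurable (Finset.univ.inf' Finset.univ_nonempty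
      fun (ij : Fin p × Fin p) (B : Matrix (Fin p) (Fin p) ℝ) =>
        if B ij.1 ij.2 = 0 then (1 : ℝ) else B ij.1 ij.2) :=
    Finset.inf'_induction (p := fun f : Matrix (Fin p) (Fin p) ℝ → ℝ => Measurable f) _ _
      (fun _ hf _ hg => hf.inf hg) fun ij _ =>
        Measurable.ite (measurable_entry ij.1 ij.2 (measurableSet_singleton 0)) measurable_const
          (measurable_entry ij.1 ij.2)
  convert h using 1
  ext B
  simp [minEntryOrOne]

lemma minEntryOrOne_pos (h : ∀ i j, 0 ≤ B i j) : 0 < minEntryOrOne B := by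
  rw [minEntryOrOne, Finset.lt_inf'_iff]
  intro ij _
  split_ifs with h0
  · exact one_pos
  · exact lt_of_le_of_ne (h _ _) (Ne.symm h0)

lemma minEntryOrOne_le {i j : Fin p} (h : 0 < B i j) : minEntryOrOne B ≤ B i j := by
  have := Finset.inf'_le (fun ij : Fin p × Fin p => if B ij.1 ij.2 = 0 then 1 else B ij.1 ij.2)
    (Finset.mem_univ (i, j))
  rwa [if_neg h.ne'] at this

/-- Entries of a column-stochastic matrix are at most `1`, so the default value `1` does not lower
the minimum. -/
lemma minEntryOrOne_eq_minNonzeroEntry (hB : B ∈ Matrix.colStochastic ℝ (Fin p))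
    (ha : Allowable B) : minEntryOrOne B = minNonzeroEntry B := by
  have h0 : ∀ i j, 0 ≤ B i j := fun _ _ => Matrix.nonneg_of_mem_colStochastic hB
  have hbdd : BddBelow {x : ℝ | x ≠ 0 ∧ ∃ i j, B i j = x} :=
    ⟨0, by rintro _ ⟨-, i, j, rfl⟩; exact h0 i j⟩
  obtain ⟨j₀, hj₀⟩ := ha.1 0
  apply le_antisymm
  · refine le_csInf ⟨_, hj₀.ne', 0, j₀, rfl⟩ ?_
    rintro _ ⟨hx, i, j, rfl⟩
    exact minEntryOrOne_le (lt_of_le_of_ne (h0 i j) hx.symm)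
  · refine Finset.le_inf' _ _ fun ij _ => ?_
    split_ifs with h
    · exact (csInf_le hbdd ⟨hj₀.ne', 0, j₀, rfl⟩).trans (Matrix.le_one_of_mem_colStochastic hB)
    · exact csInf_le hbdd ⟨h, ij.1, ij.2, rfl⟩

lemma minEntryOrOne_mul_le_mulVec (h : ∀ i j, 0 ≤ B i j) (ha : Allowable B) {v : Fin p → ℝ}
    {b : ℝ} (hb : 0 ≤ b) (hv : ∀ i, b ≤ v i) (i : Fin p) : minEntryOrOne B * b ≤ (B *ᵥ v) i := by
  obtain ⟨j, hj⟩ := ha.1 i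
  calc minEntryOrOne B * b ≤ B i j * v j :=
        mul_le_mul (minEntryOrOne_le hj) (hv j) hb hj.le
    _ ≤ ∑ j, B i j * v j :=
        Finset.single_le_sum (f := fun j => B i j * v j)
          (fun j _ => mul_nonneg (h i j) (hb.trans (hv j))) (Finset.mem_univ j)

end Entry

/-! ### Matrices close to a given non-negative matrix -/

/-- The matrices exceeding one half of `B` wherever `B` is positive. -/
def aboveHalf {p : ℕ} (B : Matrix (Fin p) (Fin p) ℝ) : Set (Matrix (Fin p) (Fin p) ℝ) :=
  {X | ∀ i j, 0 < B i j → B i j / 2 < X i j}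

lemma isOpen_aboveHalf {p : ℕ} (B : Matrix (Fin p) (Fin p) ℝ) : IsOpen (aboveHalf B) := by
  simp only [aboveHalf, Set.ofPred_forall]
  refine isOpen_iInter_of_finite fun i => isOpen_iInter_of_finite fun j =>
    isOpen_iInter_of_finite fun _ => ?_
  exact isOpen_lt continuous_const (continuous_id.matrix_elem i j)

lemma self_mem_aboveHalf {p : ℕ} (B : Matrix (Fin p) (Fin p) ℝ) : B ∈ aboveHalf B :=
  fun _ _ h => half_lt_self h

lemma list_prod_nonneg {p : ℕ} {l : List (Matrix (Fin p) (Fin p) ℝ)}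
    (hl : ∀ B ∈ l, ∀ i j, 0 ≤ B i j) (i j : Fin p) : 0 ≤ l.prod i j := by
  induction l generalizing i j with
  | nil => rw [List.prod_nil, Matrix.one_apply]; split_ifs <;> norm_num
  | cons B l ih =>
    rw [List.prod_cons, Matrix.mul_apply]
    exact Finset.sum_nonneg fun k _ => mul_nonneg (hl B (by simp) i k)
      (ih (fun C hC => hl C (by simp [hC])) k j)

lemma mulVec_le_mulVec_of_le {p : ℕ} {B : Matrix (Fin p) (Fin p) ℝ} (hB : ∀ i j, 0 ≤ B i j)
    {u v : Fin p → ℝ} (huv : ∀ i, u i ≤ v i) (i : Fin p) : (B *ᵥ u) i ≤ (B *ᵥ v) i := by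
  simp only [Matrix.mulVec, dotProduct]
  exact Finset.sum_le_sum fun j _ => mul_le_mul_of_nonneg_left (huv j) (hB i j)

/-- Iterating matrices close to the members of a list is, up to a constant, at least as good as
applying the product of the (reversed) list. -/
lemma prod_mulVec_le_of_mem_aboveHalf {p : ℕ} {M : ℕ → Matrix (Fin p) (Fin p) ℝ}
    {w : ℕ → Fin p → ℝ} (hM : ∀ n i j, 0 ≤ M n i j) (hw : ∀ n i, 0 ≤ w n i)
    (hrec : ∀ n, w (n + 1) = M n *ᵥ w n) (r : List (Matrix (Fin p) (Fin p) ℝ))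
    (hr : ∀ B ∈ r, ∀ i j, 0 ≤ B i j) (t : ℕ)
    (h : ∀ (i : ℕ) (hi : i < r.length), M (t + i) ∈ aboveHalf r[i]) (i : Fin p) :
    (1 / 2 : ℝ) ^ r.length * (r.reverse.prod *ᵥ w t) i ≤ w (t + r.length) i := by
  induction r generalizing t i with
  | nil => simp
  | cons B r ih =>
    have hr' : ∀ C ∈ r, ∀ i j, 0 ≤ C i j := fun C hC => hr C (by simp [hC])
    have hstep : ∀ i, ((1 / 2 : ℝ) • (B *ᵥ w t)) i ≤ w (t + 1) i := by
      intro i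
      rw [hrec, Pi.smul_apply, smul_eq_mul]
      simp only [Matrix.mulVec, dotProduct]
      rw [Finset.mul_sum]
      refine Finset.sum_le_sum fun j _ => ?_
      -- Where `B` vanishes, closeness says nothing and non-negativity of `M` takes over.
      have hBM : 1 / 2 * B i j ≤ M t i j := by
        rcases (hr B (by simp) i j).eq_or_lt with h0 | h0
        · rw [← h0]; simpa using hM t i j
        · have : B i j / 2 < M t i j := h 0 (by simp) i j h0
          linarith
      calc 1 / 2 * (B i j * w t j) = 1 / 2 * B i j * w t j := by ring
        _ ≤ _ := mul_le_mul_of_nonneg_right hBM (hw t j)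
    have hih := ih hr' (t + 1) (fun i hi => by
      have := h (i + 1) (by simpa using hi)
      rwa [← add_assoc, add_right_comm] at this) i
    have hpos : ∀ i j, 0 ≤ r.reverse.prod i j :=
      list_prod_nonneg fun C hC => hr' C (by simpa using hC)
    have hmono := mulVec_le_mulVec_of_le hpos hstep i
    rw [Matrix.mulVec_smul, Pi.smul_apply, smul_eq_mul, Matrix.mulVec_mulVec] at hmono
    rw [List.reverse_cons, List.prod_append, List.prod_singleton, List.length_cons, pow_succ,
      mul_assoc, show t + (r.length + 1) = t + 1 + r.length by ring]
    exact (mul_le_mul_of_nonneg_left hmono (by positivity)).trans hih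

/-! ### Blocks of an i.i.d. sequence -/

section Blocks

variable {Ω E : Type*} [MeasurableSpace Ω] [MeasurableSpace E] {μ : Measure Ω}
  {X : ℕ → Ω → E}

/-- The indicator of the event that the `j`-th block of length `m` lies in a given box. -/
noncomputable def blockIndicator (X : ℕ → Ω → E) {m : ℕ} (S : Fin m → Set E) (j : ℕ) (ω : Ω) : ℝ :=
  (Set.univ.pi S).indicator 1 fun i : Fin m => X (j * m + i) ω

lemma block_index_injective (m j : ℕ) : Function.Injective fun i : Fin m => j * m + (i : ℕ) :=
  fun _ _ h => Fin.ext (Nat.add_left_cancel h)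

lemma measurable_box_indicator {m : ℕ} {S : Fin m → Set E} (hS : ∀ i, MeasurableSet (S i)) :
    Measurable ((Set.univ.pi S).indicator (1 : (Fin m → E) → ℝ)) :=
  measurable_one.indicator (MeasurableSet.univ_pi hS)

lemma identDistrib_blockIndicator (hind : iIndepFun X μ)
    (hid : ∀ n, IdentDistrib (X n) (X 0) μ μ) {m : ℕ} {S : Fin m → Set E}
    (hS : ∀ i, MeasurableSet (S i)) (j : ℕ) :
    IdentDistrib (blockIndicator X S j) (blockIndicator X S 0) μ μ :=
  (IdentDistrib.pi (fun i : Fin m => (hid (j * m + i)).trans (hid (0 * m + i)).symm)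
    (hind.precomp (block_index_injective m j)) (hind.precomp (block_index_injective m 0))).comp
    (measurable_box_indicator hS)

/-- Distinct blocks use disjoint index sets, because dividing an index by `m` recovers its block. -/
lemma indepFun_blockIndicator (hmeas : ∀ n, Measurable (X n)) (hind : iIndepFun X μ) {m : ℕ}
    {S : Fin m → Set E} (hS : ∀ i, MeasurableSet (S i)) {j k : ℕ} (hjk : j ≠ k) :
    IndepFun (blockIndicator X S j) (blockIndicator X S k) μ := by
  let T : ℕ → Finset ℕ := fun j => Finset.univ.image fun i : Fin m => j * m + (i : ℕ)
  have hT : ∀ j (i : Fin m), j * m + (i : ℕ) ∈ T j := fun j i =>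
    Finset.mem_image_of_mem _ (Finset.mem_univ i)
  have hdisj : Disjoint (T j) (T k) := by
    rw [Finset.disjoint_left]
    intro n hn hn'
    obtain ⟨i, -, rfl⟩ := Finset.mem_image.1 hn
    obtain ⟨i', -, h⟩ := Finset.mem_image.1 hn'
    have hm : 0 < m := i.pos
    have e : ∀ (j : ℕ) (i : Fin m), (j * m + (i : ℕ)) / m = j := fun j i => by
      rw [mul_comm, Nat.mul_add_div hm, Nat.div_eq_of_lt i.2, add_zero]
    exact hjk (by rw [← e j i, ← h, e k i'])
  have hg : ∀ j, Measurable fun v : T j → E =>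
      (Set.univ.pi S).indicator (1 : (Fin m → E) → ℝ) fun i => v ⟨j * m + i, hT j i⟩ := fun j =>
    (measurable_box_indicator hS).comp (measurable_pi_lambda _ fun i => measurable_pi_apply _)
  exact (hind.indepFun_finset (T j) (T k) hdisj hmeas).comp (hg j) (hg k)

lemma integral_blockIndicator_pos [IsProbabilityMeasure μ] (hmeas : ∀ n, Measurable (X n))
    (hind : iIndepFun X μ)
    (hid : ∀ n, IdentDistrib (X n) (X 0) μ μ) {m : ℕ} {S : Fin m → Set E}
    (hS : ∀ i, MeasurableSet (S i)) (hpos : ∀ i, 0 < μ.map (X 0) (S i)) :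
    0 < ∫ ω, blockIndicator X S 0 ω ∂μ := by
  have h1 : blockIndicator X S 0
      = (⋂ i ∈ (Finset.univ : Finset (Fin m)), X (0 * m + i) ⁻¹' S i).indicator 1 := by
    ext ω
    have h2 : (fun i : Fin m => X (0 * m + i) ω) ∈ Set.univ.pi S ↔
        ω ∈ ⋂ i ∈ (Finset.univ : Finset (Fin m)), X (0 * m + i) ⁻¹' S i := by simp
    by_cases h : ω ∈ ⋂ i ∈ (Finset.univ : Finset (Fin m)), X (0 * m + i) ⁻¹' S i
    · rw [blockIndicator, Set.indicator_of_mem h, Set.indicator_of_mem (h2.2 h)]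
      rfl
    · rw [blockIndicator, Set.indicator_of_notMem h, Set.indicator_of_notMem (mt h2.1 h)]
  have hmS : MeasurableSet (⋂ i ∈ (Finset.univ : Finset (Fin m)), X (0 * m + i) ⁻¹' S i) :=
    Finset.measurableSet_biInter _ fun i _ => hmeas _ (hS i)
  rw [h1, integral_indicator_one hmS, measureReal_def, ENNReal.toReal_pos_iff]
  refine ⟨?_, measure_lt_top _ _⟩
  rw [(hind.precomp (block_index_injective m 0)).measure_inter_preimage_eq_mul Finset.univ
    (fun i _ => hS i), pos_iff_ne_zero, Finset.prod_ne_zero_iff]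
  intro i _
  rw [← Measure.map_apply (hmeas _) (hS i), (hid _).map_eq]
  exact (hpos i).ne'

lemma ae_tendsto_average_blockIndicator [IsProbabilityMeasure μ] (hmeas : ∀ n, Measurable (X n))
    (hind : iIndepFun X μ)
    (hid : ∀ n, IdentDistrib (X n) (X 0) μ μ) {m : ℕ} {S : Fin m → Set E}
    (hS : ∀ i, MeasurableSet (S i)) :
    ∀ᵐ ω ∂μ, Tendsto (fun n : ℕ => (∑ j ∈ Finset.range n, blockIndicator X S j ω) / n) atTop
      (nhds (∫ ω, blockIndicator X S 0 ω ∂μ)) := by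
  refine strong_law_ae_real (blockIndicator X S) ?_
    (fun j k hjk => indepFun_blockIndicator hmeas hind hS hjk)
    (identDistrib_blockIndicator hind hid hS)
  have hm : Measurable (blockIndicator X S 0) :=
    (measurable_box_indicator hS).comp (measurable_pi_lambda _ fun i => hmeas _)
  refine Integrable.of_bound hm.aestronglyMeasurable 1 (ae_of_all _ fun ω => ?_)
  unfold blockIndicator
  exact (norm_indicator_le_norm_self _ _).trans (by simp)

end Blocks

/-! ### The weights -/

section Weights

variable {p : ℕ} {Ω : Type*}

lemma weight_zero (A : ℕ → Ω → Matrix (Fin p) (Fin p) ℝ) (ω : Ω) : weight A 0 ω = 1 := by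
  simp [weight, prodM]

lemma weight_succ (A : ℕ → Ω → Matrix (Fin p) (Fin p) ℝ) (n : ℕ) (ω : Ω) :
    weight A (n + 1) ω = A (n + 1) ω *ᵥ weight A n ω := by
  simp [weight, prodM, Matrix.mulVec_mulVec]

variable {A : ℕ → Ω → Matrix (Fin p) (Fin p) ℝ} {ω : Ω}

lemma sum_weight (h : ∀ n, A (n + 1) ω ∈ Matrix.colStochastic ℝ (Fin p)) (n : ℕ) :
    ∑ i, weight A n ω i = p := by
  induction n with
  | zero => simp [weight_zero]
  | succ n ih => rw [weight_succ, Matrix.sum_mulVec_of_mem_colStochastic (h n), ih]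

variable [NeZero p]

lemma minWeight_le (n : ℕ) (i : Fin p) : minWeight A n ω ≤ weight A n ω i :=
  Finset.inf'_le _ (Finset.mem_univ i)

lemma minWeight_zero : minWeight A 0 ω = 1 := by
  simp [minWeight, weight_zero]

lemma minEntryOrOne_mul_minWeight_le {n : ℕ} (h : ∀ i j, 0 ≤ A (n + 1) ω i j)
    (ha : Allowable (A (n + 1) ω)) (hn : 0 ≤ minWeight A n ω) :
    minEntryOrOne (A (n + 1) ω) * minWeight A n ω ≤ minWeight A (n + 1) ω := by
  refine Finset.le_inf' _ _ fun i _ => ?_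
  rw [weight_succ]
  exact minEntryOrOne_mul_le_mulVec h ha hn (minWeight_le n) i

lemma minWeight_pos (h : ∀ n i j, 0 ≤ A (n + 1) ω i j) (ha : ∀ n, Allowable (A (n + 1) ω))
    (n : ℕ) : 0 < minWeight A n ω := by
  induction n with
  | zero => rw [minWeight_zero]; exact one_pos
  | succ n ih =>
    exact (mul_pos (minEntryOrOne_pos (h n)) ih).trans_le
      (minEntryOrOne_mul_minWeight_le (h n) (ha n) ih.le)

lemma neg_log_minWeight_succ_le {n : ℕ} (h : ∀ i j, 0 ≤ A (n + 1) ω i j)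
    (ha : Allowable (A (n + 1) ω)) (hn : 0 < minWeight A n ω) :
    -Real.log (minWeight A (n + 1) ω)
      ≤ -Real.log (minWeight A n ω) + -min (Real.log (minEntryOrOne (A (n + 1) ω))) 0 := by
  have hpos := minEntryOrOne_pos h
  have h1 := Real.log_le_log (mul_pos hpos hn) (minEntryOrOne_mul_minWeight_le h ha hn.le)
  rw [Real.log_mul hpos.ne' hn.ne'] at h1
  linarith [min_le_left (Real.log (minEntryOrOne (A (n + 1) ω))) 0]

/-- After a block of matrices close to the factors of a positive product, all weights are bounded
below by a constant. -/
lemma le_minWeight_of_mem_aboveHalf (h : ∀ n, A (n + 1) ω ∈ Matrix.colStochastic ℝ (Fin p))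
    (hpos : ∀ n, 0 < minWeight A n ω) (r : List (Matrix (Fin p) (Fin p) ℝ))
    (hr : ∀ B ∈ r, ∀ i j, 0 ≤ B i j) {δ : ℝ} (hδ : ∀ i j, δ ≤ r.reverse.prod i j) (t : ℕ)
    (ht : ∀ (i : ℕ) (hi : i < r.length), A (t + i + 1) ω ∈ aboveHalf r[i]) :
    (1 / 2 : ℝ) ^ r.length * (δ * p) ≤ minWeight A (t + r.length) ω := by
  have hw : ∀ n i, 0 ≤ weight A n ω i := fun n i => (hpos n).le.trans (minWeight_le n i)
  refine Finset.le_inf' _ _ fun i _ => ?_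
  refine le_trans ?_ (prod_mulVec_le_of_mem_aboveHalf (M := fun n => A (n + 1) ω)
    (w := fun n => weight A n ω) (fun n i j => Matrix.nonneg_of_mem_colStochastic (h n)) hw
    (fun n => weight_succ A n ω) r hr t ht i)
  refine mul_le_mul_of_nonneg_left ?_ (by positivity)
  -- Conservation of total weight makes the bound independent of `t`.
  rw [← sum_weight h t, Finset.mul_sum]
  exact Finset.sum_le_sum fun j _ => mul_le_mul_of_nonneg_right (hδ i j) (hw t j)

end Weights

/-- Strong law for the one-step losses; `minEntryOrOne` supplies measurability, and its almost sure
agreement with `minNonzeroEntry` supplies integrability. -/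
lemma StandingAssumption.ae_tendsto_average_log {p : ℕ} [NeZero p] {Ω : Type*} [MeasurableSpace Ω]
    {μ : Measure Ω} {𝒜 : Set (Matrix (Fin p) (Fin p) ℝ)}
    {A : ℕ → Ω → Matrix (Fin p) (Fin p) ℝ} (hA : StandingAssumption μ 𝒜 A) :
    ∃ a : ℝ, ∀ᵐ ω ∂μ, Tendsto (fun n : ℕ => (∑ i ∈ Finset.range n,
      -min (Real.log (minEntryOrOne (A (i + 1) ω))) 0) / n) atTop (nhds a) := by
  have hf : Measurable fun B : Matrix (Fin p) (Fin p) ℝ =>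
      -min (Real.log (minEntryOrOne B)) 0 :=
    ((Real.measurable_log.comp measurable_minEntryOrOne).min measurable_const).neg
  refine ⟨_, strong_law_ae_real (fun i ω => -min (Real.log (minEntryOrOne (A (i + 1) ω))) 0)
    (hA.logIntegrable.neg.congr ?_)
    (fun i j hij => (hA.indep.indepFun hij).comp hf hf)
    (fun i => (hA.identDistrib (i + 1) (by omega)).comp hf)⟩
  filter_upwards [hA.mem 1 le_rfl] with ω hω
  simp only [Pi.neg_apply, zero_add]
  rw [minEntryOrOne_eq_minNonzeroEntry (hA.colStochastic _ hω) (hA.allowable _ hω)]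

end RatioConsensus

open RatioConsensus in
theorem mainTheorem7 {p : ℕ} [NeZero p] {Ω : Type*} [MeasurableSpace Ω]
    (μ : Measure Ω) [IsProbabilityMeasure μ]
    (𝒜 : Set (Matrix (Fin p) (Fin p) ℝ)) (A : ℕ → Ω → Matrix (Fin p) (Fin p) ℝ)
    (hA : RatioConsensus.StandingAssumption μ 𝒜 A) :
    ∀ᵐ ω ∂μ,
      (∀ n, 0 < RatioConsensus.minWeight A n ω) ∧
      limsup (fun n : ℕ =>
        (((1 / (n : ℝ)) * Real.log (1 / RatioConsensus.minWeight A n ω) : ℝ) : EReal)) atTop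
          ≤ 0 := by
  obtain ⟨l, hl0, hl𝒜, hlpos⟩ := hA.primitive
  -- The rightmost factor acts first, so `r` lists the factors in order of time.
  set r := l.reverse with hr
  have hr𝒜 : ∀ B ∈ r, B ∈ 𝒜 := fun B hB => hl𝒜 B (by simpa [hr] using hB)
  have hrlen : 0 < r.length := by simpa [hr] using List.length_pos_iff.2 hl0
  obtain ⟨δ, hδ0, hδ⟩ : ∃ δ : ℝ, 0 < δ ∧ ∀ i j, δ ≤ r.reverse.prod i j := by
    refine ⟨Finset.univ.inf' Finset.univ_nonempty fun ij : Fin p × Fin p => l.prod ij.1 ij.2,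
      (Finset.lt_inf'_iff _).2 fun ij _ => hlpos _ _, fun i j => ?_⟩
    rw [hr, List.reverse_reverse]
    exact Finset.inf'_le (fun ij : Fin p × Fin p => l.prod ij.1 ij.2) (Finset.mem_univ (i, j))
  have hp : (0 : ℝ) < p := by exact_mod_cast Nat.pos_of_ne_zero (NeZero.ne p)
  set c : ℝ := (1 / 2 : ℝ) ^ r.length * (δ * p) with hc
  have hc0 : 0 < c := by positivity
  let S : Fin r.length → Set (Matrix (Fin p) (Fin p) ℝ) := fun i => aboveHalf r[i]
  have hS : ∀ i, MeasurableSet (S i) := fun i => (isOpen_aboveHalf _).measurableSet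
  have hSpos : ∀ i, 0 < μ.map (A (0 + 1)) (S i) := fun i =>
    (Measure.mem_support_iff_forall _).1 (hA.fullSupport (hr𝒜 _ (List.getElem_mem i.2))) _
      ((isOpen_aboveHalf _).mem_nhds (self_mem_aboveHalf _))
  have hmeas : ∀ n, Measurable (A (n + 1)) := fun n => hA.measurable _ (by omega)
  have hid : ∀ n, IdentDistrib (A (n + 1)) (A (0 + 1)) μ μ := fun n => hA.identDistrib _ (by omega)
  have hq := integral_blockIndicator_pos hmeas hA.indep hid hS hSpos
  obtain ⟨a, ha⟩ := hA.ae_tendsto_average_log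
  filter_upwards [ae_all_iff.2 fun n => hA.mem (n + 1) (by omega), ha,
    ae_tendsto_average_blockIndicator hmeas hA.indep hid hS] with ω hmem hx hy
  have hst : ∀ n, A (n + 1) ω ∈ Matrix.colStochastic ℝ (Fin p) :=
    fun n => hA.colStochastic _ (hmem n)
  have hnn : ∀ n i j, 0 ≤ A (n + 1) ω i j := fun n i j =>
    Matrix.nonneg_of_mem_colStochastic (hst n)
  have hal : ∀ n, Allowable (A (n + 1) ω) := fun n => hA.allowable _ (hmem n)
  have hpos := minWeight_pos hnn hal
  refine ⟨hpos, ?_⟩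
  have hev : ∀ ε : ℝ, 0 < ε →
      ∀ᶠ n : ℕ in atTop, 1 / (n : ℝ) * -Real.log (minWeight A n ω) ≤ ε := by
    intro ε hε
    -- The `0` in the maximum covers the start, where `minWeight` is `1`.
    refine eventually_div_le_of_reset (K := max 0 (-Real.log c)) hrlen hq ?_
      (fun n => neg_log_minWeight_succ_le (hnn n) (hal n) (hpos n)) (fun j => ?_) hx hy hε
    · simp [minWeight_zero]
    · by_cases hj : (fun i : Fin r.length => A (j * r.length + i + 1) ω) ∈ Set.univ.pi S
      · right
        refine le_max_of_le_right (neg_le_neg (Real.log_le_log hc0 ?_))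
        rw [add_one_mul]
        exact le_minWeight_of_mem_aboveHalf hst hpos r
          (fun B hB i j => Matrix.nonneg_of_mem_colStochastic (hA.colStochastic B (hr𝒜 B hB))) hδ _
          fun i hi => hj ⟨i, hi⟩ (Set.mem_univ _)
      · left
        exact Set.indicator_of_notMem hj _
  refine EReal.le_of_forall_lt_iff_le.1 fun ε hε => ?_
  refine limsup_le_of_le (by isBoundedDefault) ?_
  filter_upwards [hev ε (by exact_mod_cast hε)] with n hn
  rw [one_div (minWeight A n ω), Real.log_inv]
  exact_mod_cast hn
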